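/- **Proposition 2.** Let $X(t)$, $t\ge t_0$, be a real-valued Markov process started at $X(t_0)=x_0$, with transition probability density $p(x,t|y,s)$ $(t_0\le s<t)$; that is, given $X(r)$, $t_0\le r\le s$, the conditional law of $X(t)$ is $p(x,t|X(s),s)\,dx$. Let $$\delta Z(k,\delta|y,t)=\int e^{ik(x-y)}p(x,t+\delta|y,t)\,dx=\exp\big(\delta K(k,\delta|y,t)\big)$$ define the characteristic function $\delta Z$ and the cumulant generating function $\delta K$ of the increments. Say that *the small-time expansion holds at time $t>t_0$*, with rate $\kappa(k|y,t)=\partial_\delta\,\delta K(k,\delta|y,t)|_{\delta=0^+}$, if * for almost every $y$ with $p(y,t|x_0,t_0)\neq 0$ and every $k\in\mathbb R$: $\delta Z(k,\delta|y,t)\ne0$ for small $\delta>0$ and $\delta K(k,\delta|y,t)=\delta\,\kappa(k|y,t)+o(\delta)$ as $\delta\to0^+$ ($\delta K$ being the principal logarithm of $\delta Z$); * for every $\varphi\in C_c^\infty(\mathbb R;\mathbb C)$ there is $g$ with $\int |g(y)|\,p(y,t|x_0,t_0)\,dy<\infty$ such that, for all sufficiently small $\delta>0$ and almost every $y$ with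 $p(y,t|x_0,t_0)\ne0$, $\big|\int\varphi(x)p(x,t+\delta|y,t)\,dx-\varphi(y)\big|\le \delta\, g(y)$. Let $\frac{\partial\widetilde K}{\partial t}(\cdot|y,t)$ be the inverse Fourier transform of $\kappa(\cdot|y,t)$, that is, the distribution $\psi\mapsto\int\frac{dk}{2\pi}\,\kappa(k|y,t)\int e^{-ikx}\psi(x)\,dx$. Then $$\frac{\partial p}{\partial t}(x,t|x_0,t_0)=\int dy\,\frac{\partial\widetilde K}{\partial t}(x-y|y,t)\,p(y,t|x_0,t_0)$$ in the following senses. 1. If the small-time expansion holds at time $t>t_0$, then for almost every $y$ with $p(y,t|x_0,t_0)\ne0$ the function $\kappa(\cdot|y,t)$ is measurable and $O(1+k^2)$ (so $\frac{\partial\widetilde K}{\partial t}(\cdot|y,t)$ is a tempered distribution), and for every $\varphi\in C_c^\infty(\mathbb R;\mathbb C)$ the function $y\mapsto\big\langle\frac{\partial\widetilde K}{\partial t}(\cdot|y,t),\varphi(\cdot+y)\big\rangle\,p(y,t|x_0,t_0)$ is integrable and $s\mapsto\int\varphi(x)p(x,s|x_0,t_0)\,dx$ has at $s=t$ the right derivative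 $$\int dy\,\Big\langle\tfrac{\partial\widetilde K}{\partial t}(\cdot|y,t),\varphi(\cdot+y)\Big\rangle\,p(y,t|x_0,t_0).\qquad(*)$$ 2. If the small-time expansion holds at every $t\in(a,b)$, $a\ge t_0$, and for some $\varphi\in C_c^\infty(\mathbb R;\mathbb C)$ both $t\mapsto\int\varphi(x)p(x,t|x_0,t_0)\,dx$ and $(*)$ are continuous in $t\in(a,b)$, then the derivative in 1. is two-sided for this $\varphi$ at every $t\in(a,b)$. 3. If the small-time expansion holds at every $t\in(a,b)$, $a\ge t_0$, if $(x,t)\mapsto p(x,t|x_0,t_0)$ is continuous on $\mathbb R\times(a,b)$, and if for every $t\in(a,b)$ the distribution $(*)$ is given by a real function $q(\cdot,t)$ with $q$ continuous on $\mathbb R\times(a,b)$, then $\frac{\partial p}{\partial t}(x,t|x_0,t_0)$ exists and equals $q(x,t)$ for all $x\in\mathbb R$, $t\in(a,b)$. -/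

import Mathlib

open MeasureTheory Filter Topology
open scoped ContDiff

noncomputable section

namespace MarkovFP

/-- The past of the process `X` on the time interval `[t₀, s]`: the σ-algebra generated by
`X r`, `t₀ ≤ r ≤ s`. -/
abbrev past {Ω : Type*} (X : ℝ → Ω → ℝ) (t₀ s : ℝ) : MeasurableSpace Ω :=
  ⨆ r ∈ Set.Icc t₀ s, MeasurableSpace.comap (X r) inferInstance

/-- Under `P`, the real process `X(t)`, `t ≥ t₀`, started at `X(t₀) = x₀`, is a Markov process
with transition probability density `p`, where `p x t y s` is `p(x,t|y,s)`: given the past up to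
time `s`, the conditional law of `X(t)` is `p(x,t|X(s),s) dx`. -/
structure IsMarkovProcess {Ω : Type*} [MeasurableSpace Ω] (P : Measure Ω) (X : ℝ → Ω → ℝ)
    (p : ℝ → ℝ → ℝ → ℝ → ℝ) (x₀ t₀ : ℝ) : Prop where
  measurable_process : ∀ t, t₀ ≤ t → Measurable (X t)
  start : ∀ᵐ w ∂P, X t₀ w = x₀
  measurable_density : ∀ s t, t₀ ≤ s → s < t → Measurable (fun z : ℝ × ℝ => p z.1 t z.2 s)
  density_nonneg : ∀ s t, t₀ ≤ s → s < t → ∀ x y, 0 ≤ p x t y s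
  integral_density : ∀ s t, t₀ ≤ s → s < t → ∀ y, ∫ x, p x t y s = 1
  markov : ∀ s t, t₀ ≤ s → s < t → ∀ A : Set ℝ, MeasurableSet A →
    P[(X t ⁻¹' A).indicator (fun _ => (1 : ℝ)) | past X t₀ s]
      =ᵐ[P] fun w => ∫ x in A, p x t (X s w) s

/-- First characteristic function of the increment over a time lag `δ`,
`δZ(k,δ|y,t) = E[exp(ik(X(t+δ)-X(t))) | X(t) = y]`. -/
def incrementCF (p : ℝ → ℝ → ℝ → ℝ → ℝ) (k δ y t : ℝ) : ℂ :=
  ∫ x : ℝ, Complex.exp (Complex.I * k * (x - y)) * (p x (t + δ) y t : ℂ)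

/-- Cumulant generating function (second characteristic function) of the increment,
`δZ = exp(δK)`. It is used only for `δ → 0⁺` at fixed `(k, y, t)`, where `δZ → 1`, and there the
principal branch is the branch that vanishes in the limit. -/
def incrementCGF (p : ℝ → ℝ → ℝ → ℝ → ℝ) (k δ y t : ℝ) : ℂ :=
  Complex.log (incrementCF p k δ y t)

/-- `c` is the time derivative at lag `0⁺` of the cumulant generating function of the increments:
`δK(k,δ|y,t) = δ c + o(δ)`. The first clause says that `δK` is a genuine logarithm of `δZ`. -/
def HasCumulantRate (p : ℝ → ℝ → ℝ → ℝ → ℝ) (k y t : ℝ) (c : ℂ) : Prop :=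
  (∀ᶠ δ in 𝓝[>] (0 : ℝ), incrementCF p k δ y t ≠ 0) ∧
    (fun δ : ℝ => incrementCGF p k δ y t - δ * c) =o[𝓝[>] (0 : ℝ)] (fun δ : ℝ => δ)

/-- Test functions: smooth with compact support. -/
def IsTestFunction (φ : ℝ → ℂ) : Prop :=
  ContDiff ℝ ∞ φ ∧ HasCompactSupport φ

/-- The small-time expansion of the increments at time `t`, seen from `(x₀, t₀)`, with cumulant
rate `κ k y t`: for almost every position `y` that the process can occupy at time `t`, the
expansion of the cumulant generating function holds at every `k`; and the conditional
mean increments `E[φ(X(t+δ)) - φ(X(t)) | X(t) = y]` of each test function are at most `δ g(y)`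
for small `δ`, with `g` integrable for the law `p(y,t|x₀,t₀) dy`. -/
structure HasSmallTimeExpansion (p : ℝ → ℝ → ℝ → ℝ → ℝ) (κ : ℝ → ℝ → ℝ → ℂ)
    (x₀ t₀ t : ℝ) : Prop where
  rate : ∀ᵐ y, p y t x₀ t₀ ≠ 0 → ∀ k, HasCumulantRate p k y t (κ k y t)
  dominated : ∀ φ, IsTestFunction φ → ∃ g : ℝ → ℝ,
    Integrable (fun y => g y * p y t x₀ t₀) ∧
    ∀ᶠ δ in 𝓝[>] (0 : ℝ), ∀ᵐ y, p y t x₀ t₀ ≠ 0 →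
      ‖(∫ x, φ x * (p x (t + δ) y t : ℂ)) - φ y‖ ≤ δ * g y

/-- The distribution `F⁻¹[f]`, with `F⁻¹[f](x) = ∫ dk/(2π) exp(-ikx) f(k)`, evaluated at a test
function `ψ`. -/
def invFourierPairing (f ψ : ℝ → ℂ) : ℂ :=
  ∫ k : ℝ, f k * ((2 * Real.pi : ℂ)⁻¹ * ∫ x : ℝ, Complex.exp (-(Complex.I * k * x)) * ψ x)

/-- The distribution `x ↦ ∂K̃/∂t(x - y|y,t)` evaluated at `φ`, where `∂K̃/∂t(·|y,t)` is the inverse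
Fourier transform of `κ(·|y,t)`. -/
def kernelPairing (κ : ℝ → ℝ → ℝ → ℂ) (φ : ℝ → ℂ) (y t : ℝ) : ℂ :=
  invFourierPairing (fun k => κ k y t) (fun z => φ (z + y))

/-- The distribution `x ↦ ∫ dy ∂K̃/∂t(x - y|y,t) p(y,t|x₀,t₀)` evaluated at `φ`. -/
def generatedPairing (p : ℝ → ℝ → ℝ → ℝ → ℝ) (κ : ℝ → ℝ → ℝ → ℂ) (x₀ t₀ : ℝ)
    (φ : ℝ → ℂ) (t : ℝ) : ℂ :=
  ∫ y, kernelPairing κ φ y t * (p y t x₀ t₀ : ℂ)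

/-- The distribution `x ↦ p(x,t|x₀,t₀)` evaluated at `φ`. -/
def densityPairing (p : ℝ → ℝ → ℝ → ℝ → ℝ) (x₀ t₀ : ℝ) (φ : ℝ → ℂ) (t : ℝ) : ℂ :=
  ∫ x, φ x * (p x t x₀ t₀ : ℂ)

end MarkovFP

end

/-! By Chapman–Kolmogorov, the difference quotient of `∫ φ p` at time `t` with lag `δ` is the
average over the law `p(y,t|x₀,t₀) dy` of the rates `(E[φ(X(t+δ)) | X(t) = y] - φ(y)) / δ`. Fourier
inversion writes each rate as the integral over `k` of `(δZ - 1)/δ` against the transform of `φ(· +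
y)` (`integral_mul_sub_eq`), and `(δZ - 1)/δ → κ` for each `k` because `exp z - 1 ~ z`. Two passages
to the limit under an integral give the right derivative (`forward_equation`). Over `y` the majorant
is the hypothesis `dominated`; over `k` it must be proved.

That majorant is the heart of the matter (`exists_uniform_quadratic_bound`). For each lag, `N(k) =
|δZ(k) - 1|` is even and satisfies `N(k+l) ≤ 2(N(k) + N(l))`. Pointwise convergence and Baire's
theorem bound `N/δ` on some interval, uniformly for small `δ`; the inequality moves the interval to
the origin and, by doubling, spreads the bound to `C(1+k²)`. The transform of a test function is
Schwartz, hence integrable against this weight. The bound also passes to the limit `κ`.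

A continuous function with a continuous right derivative is the integral of that derivative, hence
two-sided differentiable. For the pointwise equation, this is applied to each pairing with a test
function; Fubini and the fundamental lemma of the calculus of variations then give `p(x,t) - p(x,s)
= ∫ q(x,r) dr`, for every `x` by continuity. -/

namespace MarkovFP

/-! ### Uniform quadratic bounds from pointwise convergence -/

/-- A function with `G (k + l) ≤ 2 (G k + G l)` that is bounded near the origin grows at most
quadratically. -/
theorem quadratic_growth_of_add_le {G : ℝ → ℝ} {M r : ℝ} (hr : 0 < r) (hM : 0 ≤ M)
    (hG : ∀ k l, G (k + l) ≤ 2 * (G k + G l)) (hb : ∀ k, |k| ≤ r → G k ≤ M) (k : ℝ) :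
    G k ≤ 4 * M * (1 + (k / r) ^ 2) := by
  have dyadic : ∀ n : ℕ, ∀ k, |k| ≤ 2 ^ n * r → G k ≤ 4 ^ n * M := by
    intro n
    induction n with
    | zero => intro k hk; simpa using hb k (by simpa using hk)
    | succ n ih =>
      intro k hk
      have h := ih (k / 2) (by rw [abs_div, abs_two]; rw [pow_succ] at hk; linarith)
      have h2 := hG (k / 2) (k / 2)
      rw [add_halves] at h2
      rw [pow_succ]
      linarith
  rcases le_or_gt |k| r with h | h
  · have := hb k h
    nlinarith [mul_nonneg hM (sq_nonneg (k / r))]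
  -- With `2^n ≤ |k|/r < 2^(n+1)`, the dyadic bound at level `n + 1` overshoots `(k/r)^2` by at most
  -- a factor 4, the constant of the statement.
  · obtain ⟨n, hn1, hn2⟩ := exists_nat_pow_near (x := |k| / r) (y := 2)
      (by rw [le_div_iff₀ hr]; linarith) one_lt_two
    have h1 := dyadic (n + 1) k (by rw [div_lt_iff₀ hr] at hn2; exact hn2.le)
    have h2 : (4 : ℝ) ^ n ≤ (k / r) ^ 2 := by
      rw [← sq_abs, abs_div, abs_of_pos hr, show (4 : ℝ) = 2 ^ 2 by norm_num, ← pow_mul, mul_comm,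
        pow_mul]
      exact pow_le_pow_left₀ (by positivity) hn1 2
    rw [pow_succ] at h1
    nlinarith [mul_le_mul_of_nonneg_right h2 hM]

/-- Pointwise convergence of a family of continuous functions with
`‖F δ (k + l)‖ ≤ 2 (‖F δ k‖ + ‖F δ l‖)` implies a quadratic bound which is uniform in the
parameter. -/
theorem exists_uniform_quadratic_bound {F : ℝ → ℝ → ℂ} {c : ℝ → ℂ}
    (hcont : ∀ δ, 0 < δ → Continuous (F δ))
    (hadd : ∀ δ, 0 < δ → ∀ k l, ‖F δ (k + l)‖ ≤ 2 * (‖F δ k‖ + ‖F δ l‖))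
    (hneg : ∀ δ, 0 < δ → ∀ k, ‖F δ (-k)‖ = ‖F δ k‖)
    (hlim : ∀ k, Tendsto (fun δ => F δ k) (𝓝[>] 0) (𝓝 (c k))) :
    ∃ C : ℝ, 0 ≤ C ∧ ∀ᶠ δ in 𝓝[>] (0 : ℝ), ∀ k, ‖F δ k‖ ≤ C * (1 + k ^ 2) := by
  -- One index `N` controls both the range of lags and the bound, so the closed sets `E N` cover the
  -- line and Baire's theorem applies.
  let E : ℕ → Set ℝ := fun N => {k | ∀ δ ∈ Set.Ioo (0 : ℝ) (1 / (N + 1)), ‖F δ k‖ ≤ N}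
  have hE : ∀ N, IsClosed (E N) := by
    intro N
    have : E N = ⋂ δ ∈ Set.Ioo (0 : ℝ) (1 / (N + 1)), {k | ‖F δ k‖ ≤ N} := by
      ext k; simp [E]
    rw [this]
    exact isClosed_biInter fun δ hδ => isClosed_le (hcont δ hδ.1).norm continuous_const
  have hU : ⋃ N, E N = Set.univ := by
    refine Set.eq_univ_of_forall fun k => Set.mem_iUnion.2 ?_
    have h1 : ∀ᶠ δ in 𝓝[>] (0 : ℝ), ‖F δ k‖ < ‖c k‖ + 1 :=
      (hlim k).norm.eventually (gt_mem_nhds (lt_add_one _))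
    obtain ⟨ε, hε, h2⟩ := mem_nhdsGT_iff_exists_Ioo_subset.1 h1
    obtain ⟨N₁, hN₁⟩ := exists_nat_one_div_lt (Set.mem_Ioi.1 hε)
    obtain ⟨N₂, hN₂⟩ := exists_nat_ge (‖c k‖ + 1)
    refine ⟨max N₁ N₂, fun δ hδ => ?_⟩
    have h3 : (1 : ℝ) / ((max N₁ N₂ : ℕ) + 1) ≤ 1 / (N₁ + 1) := by
      apply one_div_le_one_div_of_le (by positivity)
      have : (N₁ : ℝ) ≤ (max N₁ N₂ : ℕ) := by exact_mod_cast le_max_left _ _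
      linarith
    have h4 : ‖F δ k‖ < ‖c k‖ + 1 := h2 ⟨hδ.1, by linarith [hδ.2]⟩
    have h5 : (N₂ : ℝ) ≤ (max N₁ N₂ : ℕ) := by exact_mod_cast le_max_right _ _
    linarith
  obtain ⟨N, k₀, hk₀⟩ := nonempty_interior_of_iUnion_of_closed hE hU
  obtain ⟨r, hr, hball⟩ := Metric.nhds_basis_closedBall.mem_iff.1 (mem_interior_iff_mem_nhds.1 hk₀)
  refine ⟨4 * (4 * N) * (1 + 1 / r ^ 2), by positivity, ?_⟩
  have hN : (0 : ℝ) < 1 / (N + 1) := by positivity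
  filter_upwards [Ioo_mem_nhdsGT hN] with δ hδ k
  have h1 : ∀ k, |k| ≤ r → ‖F δ k‖ ≤ 4 * N := by
    intro k hk
    have h2 : ‖F δ (k₀ + k)‖ ≤ N := hball (by simpa [Real.dist_eq] using hk) δ hδ
    have h3 : ‖F δ k₀‖ ≤ N := hball (Metric.mem_closedBall_self hr.le) δ hδ
    -- The ball around `k₀` is moved to the origin by writing `k = (k₀ + k) + (-k₀)`; evenness
    -- bounds the second term.
    have h4 := hadd δ hδ.1 (k₀ + k) (-k₀)
    rw [hneg δ hδ.1, show k₀ + k + -k₀ = k by ring] at h4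
    linarith
  refine (quadratic_growth_of_add_le hr (by positivity) (hadd δ hδ.1) h1 k).trans ?_
  rw [mul_assoc _ (1 + 1 / r ^ 2)]
  refine mul_le_mul_of_nonneg_left ?_ (by positivity)
  have : (1 + 1 / r ^ 2) * (1 + k ^ 2) = 1 + (k / r) ^ 2 + (k ^ 2 + 1 / r ^ 2) := by
    rw [div_pow]; ring
  rw [this]
  have : 0 ≤ k ^ 2 + 1 / r ^ 2 := by positivity
  linarith

/-! ### Characteristic functions of increments and cumulant rates -/

/-- Characteristic function of the law `f(x) dx`, centred at `y`. -/
noncomputable def centredCF (f : ℝ → ℝ) (y k : ℝ) : ℂ :=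
  ∫ x : ℝ, Complex.exp (Complex.I * k * (x - y)) * (f x : ℂ)

theorem cexp_I_mul_eq (k x y : ℝ) :
    Complex.exp (Complex.I * k * (x - y)) = Complex.exp ((k * (x - y) : ℝ) * Complex.I) := by
  push_cast; ring_nf

theorem norm_cexp_phase (k x y : ℝ) : ‖Complex.exp (Complex.I * k * (x - y))‖ = 1 := by
  rw [cexp_I_mul_eq, Complex.norm_exp_ofReal_mul_I]

theorem integrable_phase_mul {f : ℝ → ℝ} (hf : Integrable f) (y k : ℝ) :
    Integrable (fun x : ℝ => Complex.exp (Complex.I * k * (x - y)) * (f x : ℂ)) := by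
  refine hf.ofReal.bdd_mul (c := 1) (by fun_prop) ?_
  exact ae_of_all _ fun x => (norm_cexp_phase k x y).le

theorem continuous_centredCF {f : ℝ → ℝ} (hf : Integrable f) (y : ℝ) :
    Continuous (centredCF f y) := by
  refine continuous_of_dominated (bound := fun x => ‖f x‖)
    (fun k => (integrable_phase_mul hf y k).aestronglyMeasurable)
    (fun k => ae_of_all _ fun x => ?_) hf.norm (ae_of_all _ fun x => by fun_prop)
  rw [norm_mul, norm_cexp_phase, one_mul, Complex.norm_real]

theorem centredCF_neg (f : ℝ → ℝ) (y k : ℝ) :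
    centredCF f y (-k) = (starRingEnd ℂ) (centredCF f y k) := by
  unfold centredCF
  rw [← integral_conj]
  congr 1; ext x
  rw [map_mul, Complex.conj_ofReal, ← Complex.exp_conj]
  simp

/-- On the unit circle `|z - 1|² = 2(1 - Re z)`; the rest is the inequality `2uv ≤ u² + v²`. The
right-hand side is linear in `a` and `b`, so it integrates to characteristic functions. -/
theorem norm_sub_one_mul_sub_one_le {a b : ℂ} (ha : ‖a‖ = 1) (hb : ‖b‖ = 1) :
    ‖(a - 1) * (b - 1)‖ ≤ (1 - a.re) + (1 - b.re) := by
  have key : ∀ z : ℂ, ‖z‖ = 1 → ‖z - 1‖ ^ 2 = 2 * (1 - z.re) := by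
    intro z hz
    have h1 : Complex.normSq z = 1 := by rw [Complex.normSq_eq_norm_sq, hz]; norm_num
    rw [← Complex.normSq_eq_norm_sq, Complex.normSq_sub, h1]
    simp; ring
  rw [norm_mul]
  nlinarith [key a ha, key b hb, sq_nonneg (‖a - 1‖ - ‖b - 1‖)]

/-- Since `e_{k+l} = e_k e_l`, the combination `Z(k+l) - Z(k) - Z(l) + 1` is the integral of `(e_k -
1)(e_l - 1) f`, controlled by the real parts of `1 - Z(k)` and `1 - Z(l)`. Being linear in `|Z -
1|`, the inequality survives division by the lag. -/
theorem norm_centredCF_add_sub_one_le {f : ℝ → ℝ} (hf : Integrable f) (h0 : ∀ x, 0 ≤ f x)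
    (h1 : ∫ x, f x = 1) (y k l : ℝ) :
    ‖centredCF f y (k + l) - 1‖ ≤ 2 * (‖centredCF f y k - 1‖ + ‖centredCF f y l - 1‖) := by
  let e : ℝ → ℝ → ℂ := fun k x => Complex.exp (Complex.I * k * (x - y))
  have hint : ∀ k, Integrable (fun x => e k x * (f x : ℂ)) := integrable_phase_mul hf y
  have hfc : Integrable (fun x => (f x : ℂ)) := hf.ofReal
  have h1' : ∫ x, (f x : ℂ) = 1 := by rw [integral_complex_ofReal, h1]; rfl
  have hdef : ∀ k, centredCF f y k = ∫ x, e k x * (f x : ℂ) := fun k => rfl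
  have hre : ∀ k, ∫ x, (1 - (e k x).re) * f x = (1 - centredCF f y k).re := by
    intro k
    have : ∀ x, (1 - (e k x).re) * f x = RCLike.re ((f x : ℂ) - e k x * (f x : ℂ)) := by
      intro x; simp [sub_mul]
    have hd : Integrable (fun x => (f x : ℂ) - e k x * (f x : ℂ)) := hfc.sub (hint k)
    simp_rw [this]
    rw [integral_re hd, integral_sub hfc (hint k), hdef k, h1']
    rfl
  have hprod : centredCF f y (k + l) - centredCF f y k - centredCF f y l + 1
      = ∫ x, (e k x - 1) * (e l x - 1) * (f x : ℂ) := by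
    have : ∀ x, (e k x - 1) * (e l x - 1) * (f x : ℂ)
        = e (k + l) x * (f x : ℂ) - e k x * (f x : ℂ) - e l x * (f x : ℂ) + (f x : ℂ) := by
      intro x
      have : e (k + l) x = e k x * e l x := by
        simp only [e]; rw [← Complex.exp_add]; push_cast; ring_nf
      rw [this]; ring
    have hs : Integrable (fun x => e (k + l) x * (f x : ℂ) - e k x * (f x : ℂ)) :=
      (hint _).sub (hint k)
    have hs' : Integrable (fun x => e (k + l) x * (f x : ℂ) - e k x * (f x : ℂ)
        - e l x * (f x : ℂ)) := hs.sub (hint l)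
    simp_rw [this]
    rw [integral_add hs' hfc, integral_sub hs (hint l), integral_sub (hint _) (hint k), h1']
    rfl
  have hbound : ‖centredCF f y (k + l) - centredCF f y k - centredCF f y l + 1‖
      ≤ (1 - centredCF f y k).re + (1 - centredCF f y l).re := by
    have hi : ∀ k, Integrable (fun x => (1 - (e k x).re) * f x) := by
      intro k
      have : (fun x => (1 - (e k x).re) * f x) =
          fun x => RCLike.re ((f x : ℂ) - e k x * (f x : ℂ)) := by
        ext x; simp [sub_mul]
      rw [this]
      exact (hfc.sub (hint k)).re
    rw [hprod, ← hre k, ← hre l, ← integral_add (hi k) (hi l)]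
    refine norm_integral_le_of_norm_le ((hi k).add (hi l)) (ae_of_all _ fun x => ?_)
    rw [norm_mul, Complex.norm_real, Real.norm_of_nonneg (h0 x), ← add_mul]
    exact mul_le_mul_of_nonneg_right
      (norm_sub_one_mul_sub_one_le (norm_cexp_phase _ _ _) (norm_cexp_phase _ _ _)) (h0 x)
  have ha : ∀ k, (1 - centredCF f y k).re ≤ ‖centredCF f y k - 1‖ := by
    intro k; rw [norm_sub_rev]; exact Complex.re_le_norm _
  have hsplit : centredCF f y (k + l) - 1
      = (centredCF f y (k + l) - centredCF f y k - centredCF f y l + 1)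
        + (centredCF f y k - 1) + (centredCF f y l - 1) := by ring
  rw [hsplit]
  refine (norm_add₃_le).trans ?_
  linarith [ha k, ha l]

/-- If `log Z(δ) = δ c + o(δ)` then `(Z(δ) - 1) / δ → c`. -/
theorem HasCumulantRate.tendsto {p : ℝ → ℝ → ℝ → ℝ → ℝ} {k y t : ℝ} {c : ℂ}
    (h : HasCumulantRate p k y t c) :
    Tendsto (fun δ : ℝ => (incrementCF p k δ y t - 1) / (δ : ℂ)) (𝓝[>] 0) (𝓝 c) := by
  obtain ⟨hne, ho⟩ := h
  have hδ : Tendsto (fun δ : ℝ => (δ : ℂ)) (𝓝[>] 0) (𝓝 0) := by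
    have : Tendsto (fun δ : ℝ => (δ : ℂ)) (𝓝 0) (𝓝 ((0 : ℝ) : ℂ)) :=
      Complex.continuous_ofReal.tendsto 0
    simpa using this.mono_left nhdsWithin_le_nhds
  have hpos : ∀ᶠ δ : ℝ in 𝓝[>] 0, (δ : ℂ) ≠ 0 := by
    filter_upwards [self_mem_nhdsWithin] with δ h
    exact Complex.ofReal_ne_zero.2 (Set.mem_Ioi.1 h).ne.symm
  have hK : Tendsto (fun δ : ℝ => incrementCGF p k δ y t / (δ : ℂ)) (𝓝[>] 0) (𝓝 c) := by
    have h1 : (fun δ : ℝ => incrementCGF p k δ y t - δ * c) =o[𝓝[>] (0 : ℝ)]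
        (fun δ : ℝ => (δ : ℂ)) := by
      refine ho.trans_isBigO (Asymptotics.IsBigO.of_bound 1 (Eventually.of_forall fun δ => ?_))
      simp
    have h2 := h1.tendsto_div_nhds_zero.add_const c
    rw [zero_add] at h2
    refine h2.congr' ?_
    filter_upwards [hpos] with δ h
    field_simp
    ring
  have hK0 : Tendsto (fun δ : ℝ => incrementCGF p k δ y t) (𝓝[>] 0) (𝓝 0) := by
    have := hK.mul hδ
    rw [mul_zero] at this
    refine this.congr' ?_
    filter_upwards [hpos] with δ h
    field_simp
  -- `dslope` is `(exp z - 1)/z` with the value 1 at `z = 0`, so lags at which `δK` vanishes need no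
  -- separate treatment.
  have hexp : Tendsto (fun z : ℂ => dslope Complex.exp 0 z) (𝓝 0) (𝓝 1) := by
    have hd : DifferentiableAt ℂ Complex.exp 0 := Complex.differentiable_exp 0
    have := (continuousAt_dslope_same.2 hd).tendsto
    simpa [dslope_same] using this
  have hfin := (hexp.comp hK0).mul hK
  rw [one_mul] at hfin
  refine hfin.congr' ?_
  filter_upwards [hne, hpos] with δ h h'
  have hZ : Complex.exp (incrementCGF p k δ y t) = incrementCF p k δ y t := Complex.exp_log h
  have := sub_smul_dslope Complex.exp 0 (incrementCGF p k δ y t)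
  simp only [sub_zero, smul_eq_mul, Complex.exp_zero, hZ] at this
  simp only [Function.comp]
  rw [← this]; ring

/-- The rates `(δZ - 1)/δ` satisfy a quadratic bound which is uniform for small `δ`. -/
theorem exists_incrementCF_bound {p : ℝ → ℝ → ℝ → ℝ → ℝ} {y t : ℝ} {c : ℝ → ℂ}
    (hi : ∀ δ, 0 < δ → Integrable (fun x => p x (t + δ) y t))
    (h0 : ∀ δ, 0 < δ → ∀ x, 0 ≤ p x (t + δ) y t)
    (h1 : ∀ δ, 0 < δ → ∫ x, p x (t + δ) y t = 1)
    (hc : ∀ k, HasCumulantRate p k y t (c k)) :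
    ∃ C : ℝ, 0 ≤ C ∧ ∀ᶠ δ in 𝓝[>] (0 : ℝ), ∀ k,
      ‖(incrementCF p k δ y t - 1) / (δ : ℂ)‖ ≤ C * (1 + k ^ 2) := by
  have hcf : ∀ δ k, incrementCF p k δ y t = centredCF (fun x => p x (t + δ) y t) y k :=
    fun _ _ => rfl
  refine exists_uniform_quadratic_bound (c := c)
    (F := fun δ k => (incrementCF p k δ y t - 1) / (δ : ℂ)) ?_ ?_ ?_ (fun k => (hc k).tendsto)
  · intro δ hδ
    simp only [hcf]
    exact ((continuous_centredCF (hi δ hδ) y).sub continuous_const).div_const _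
  · intro δ hδ k l
    simp only [hcf, norm_div]
    rw [← add_div, ← mul_div_assoc]
    exact div_le_div_of_nonneg_right
      (norm_centredCF_add_sub_one_le (hi δ hδ) (h0 δ hδ) (h1 δ hδ) y k l) (norm_nonneg _)
  · intro δ hδ k
    simp only [hcf, norm_div, centredCF_neg]
    rw [← RCLike.norm_conj (centredCF (fun x => p x (t + δ) y t) y k - 1)]
    simp

/-- The cumulant rate is measurable with at most quadratic growth. -/
theorem cumulantRate_measurable_and_bound {p : ℝ → ℝ → ℝ → ℝ → ℝ} {y t : ℝ} {c : ℝ → ℂ}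
    (hi : ∀ δ, 0 < δ → Integrable (fun x => p x (t + δ) y t))
    (h0 : ∀ δ, 0 < δ → ∀ x, 0 ≤ p x (t + δ) y t)
    (h1 : ∀ δ, 0 < δ → ∫ x, p x (t + δ) y t = 1)
    (hc : ∀ k, HasCumulantRate p k y t (c k)) :
    Measurable c ∧ ∃ C : ℝ, ∀ k, ‖c k‖ ≤ C * (1 + k ^ 2) := by
  constructor
  · have hu : Tendsto (fun n : ℕ => (1 : ℝ) / (n + 1)) atTop (𝓝[>] 0) :=
      tendsto_nhdsWithin_iff.2 ⟨tendsto_one_div_add_atTop_nhds_zero_nat,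
        Eventually.of_forall fun n => Set.mem_Ioi.2 (by positivity)⟩
    refine measurable_of_tendsto_metrizable
      (f := fun (n : ℕ) k => (incrementCF p k (1 / (n + 1)) y t - 1) / ((1 / (n + 1) : ℝ) : ℂ))
      (fun n => ?_) (tendsto_pi_nhds.2 fun k => (hc k).tendsto.comp hu)
    have := continuous_centredCF (hi (1 / (n + 1)) (by positivity)) y
    exact ((this.sub continuous_const).div_const _).measurable
  · obtain ⟨C, -, hC⟩ := exists_incrementCF_bound hi h0 h1 hc
    exact ⟨C, fun k => le_of_tendsto (hc k).tendsto.norm (hC.mono fun δ h => h k)⟩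

end MarkovFP

/-! ### Fourier inversion and the limit of the increment rates -/

namespace MarkovFP

open scoped FourierTransform

/-- The Fourier transform `(2π)⁻¹ ∫ exp(-ikx) ψ(x) dx`. -/
noncomputable def normalizedFT (ψ : ℝ → ℂ) (k : ℝ) : ℂ :=
  (2 * Real.pi : ℂ)⁻¹ * ∫ x : ℝ, Complex.exp (-(Complex.I * k * x)) * ψ x

theorem normalizedFT_eq (ψ : ℝ → ℂ) (k : ℝ) :
    normalizedFT ψ k = (2 * Real.pi : ℂ)⁻¹ * 𝓕 ψ ((2 * Real.pi)⁻¹ * k) := by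
  rw [normalizedFT, Real.fourier_eq']
  congr 2
  ext x
  rw [smul_eq_mul]
  congr 2
  have : (Real.pi : ℂ) ≠ 0 := Complex.ofReal_ne_zero.2 Real.pi_ne_zero
  simp
  field_simp

theorem IsTestFunction.comp_add_right {φ : ℝ → ℂ} (hφ : IsTestFunction φ) (y : ℝ) :
    IsTestFunction (fun z => φ (z + y)) :=
  ⟨hφ.1.comp (contDiff_id.add contDiff_const), hφ.2.comp_homeomorph (Homeomorph.addRight y)⟩

theorem IsTestFunction.integrable_fourier {ψ : ℝ → ℂ} (hψ : IsTestFunction ψ) :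
    Integrable (𝓕 ψ) :=
  (𝓕 (hψ.2.toSchwartzMap hψ.1)).integrable

theorem IsTestFunction.integrable_sq_mul_fourier {ψ : ℝ → ℂ} (hψ : IsTestFunction ψ) :
    Integrable (fun w => ‖w‖ ^ 2 * ‖𝓕 ψ w‖) :=
  (𝓕 (hψ.2.toSchwartzMap hψ.1)).integrable_pow_mul volume 2

theorem IsTestFunction.integrable_normalizedFT {ψ : ℝ → ℂ} (hψ : IsTestFunction ψ) :
    Integrable (normalizedFT ψ) := by
  rw [show normalizedFT ψ = _ from funext (normalizedFT_eq ψ)]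
  exact (hψ.integrable_fourier.comp_mul_left' (inv_ne_zero Real.two_pi_pos.ne')).const_mul _

theorem IsTestFunction.integrable_one_add_sq_mul_normalizedFT {ψ : ℝ → ℂ}
    (hψ : IsTestFunction ψ) : Integrable (fun k => (1 + k ^ 2) * ‖normalizedFT ψ k‖) := by
  -- With `w = k/(2π)`, the factor `k² = (2π)² w²` times the normalization `(2π)⁻¹` leaves `2π`.
  have h1 := (hψ.integrable_sq_mul_fourier.comp_mul_left'
    (inv_ne_zero Real.two_pi_pos.ne')).const_mul (2 * Real.pi)
  refine (hψ.integrable_normalizedFT.norm.add h1).congr (ae_of_all _ fun k => ?_)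
  simp only [Pi.add_apply]
  rw [add_mul, one_mul]
  congr 1
  have hnorm : ‖(2 * Real.pi : ℂ)⁻¹‖ = (2 * Real.pi)⁻¹ := by
    simp [abs_of_pos Real.pi_pos]
  rw [normalizedFT_eq, norm_mul _ (𝓕 ψ _), hnorm, Real.norm_eq_abs, sq_abs]
  have := Real.pi_ne_zero
  field_simp

/-- Fourier inversion for test functions. -/
theorem IsTestFunction.eq_integral_normalizedFT {ψ : ℝ → ℂ} (hψ : IsTestFunction ψ) (z : ℝ) :
    ψ z = ∫ k : ℝ, Complex.exp (Complex.I * k * z) * normalizedFT ψ k := by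
  have h1 : 𝓕⁻ (𝓕 ψ) z = ψ z :=
    congrFun (hψ.1.continuous.fourierInv_fourier_eq
      (hψ.1.continuous.integrable_of_hasCompactSupport hψ.2) hψ.integrable_fourier) z
  rw [← h1, Real.fourierInv_eq']
  have h2 := Measure.integral_comp_mul_left
    (fun v : ℝ => Complex.exp ((↑(2 * Real.pi * (inner ℝ v z)) * Complex.I)) • 𝓕 ψ v)
    (2 * Real.pi)⁻¹
  rw [inv_inv, abs_of_pos Real.two_pi_pos] at h2
  have hpi : (Real.pi : ℂ) ≠ 0 := Complex.ofReal_ne_zero.2 Real.pi_ne_zero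
  have h3 : ∀ k : ℝ, Complex.exp (Complex.I * k * z) * normalizedFT ψ k
      = (2 * Real.pi : ℂ)⁻¹ * (Complex.exp ((↑(2 * Real.pi * (inner ℝ ((2 * Real.pi)⁻¹ * k) z))
        * Complex.I)) • 𝓕 ψ ((2 * Real.pi)⁻¹ * k)) := by
    intro k
    have : (↑(2 * Real.pi * (inner ℝ ((2 * Real.pi)⁻¹ * k) z)) * Complex.I : ℂ)
        = Complex.I * k * z := by
      simp
      field_simp
    rw [this, normalizedFT_eq, smul_eq_mul]
    ring
  simp_rw [h3]
  rw [integral_const_mul, h2, Complex.real_smul, ← mul_assoc]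
  have h4 : (2 * Real.pi : ℂ)⁻¹ * ((2 * Real.pi : ℝ) : ℂ) = 1 := by
    push_cast
    field_simp
  rw [h4, one_mul]

/-- The mean increment of a test function in terms of the characteristic function. -/
theorem integral_mul_sub_eq {f : ℝ → ℝ} (hf : Integrable f) {φ : ℝ → ℂ}
    (hφ : IsTestFunction φ) (y : ℝ) :
    (∫ x, φ x * (f x : ℂ)) - φ y
      = ∫ k : ℝ, (centredCF f y k - 1) * normalizedFT (fun z => φ (z + y)) k := by
  have hψ := hφ.comp_add_right y
  set ψ : ℝ → ℂ := fun z => φ (z + y) with hψdef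
  have hinv : ∀ x, φ x = ∫ k : ℝ, Complex.exp (Complex.I * k * (x - y)) * normalizedFT ψ k := by
    intro x
    have := hψ.eq_integral_normalizedFT (x - y)
    simpa [hψdef] using this
  have hy : φ y = ∫ k : ℝ, normalizedFT ψ k := by
    rw [hinv y]; simp
  have hswap : ∫ x, φ x * (f x : ℂ) = ∫ k : ℝ, centredCF f y k * normalizedFT ψ k := by
    have hi : Integrable (Function.uncurry fun x k : ℝ =>
        Complex.exp (Complex.I * k * (x - y)) * ((f x : ℂ) * normalizedFT ψ k))
        (volume.prod volume) := by
      have : Integrable (fun z : ℝ × ℝ => (f z.1 : ℂ) * normalizedFT ψ z.2)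
          (volume.prod volume) := Integrable.mul_prod hf.ofReal hψ.integrable_normalizedFT
      refine this.bdd_mul (c := 1) (by fun_prop) (ae_of_all _ fun z => ?_)
      exact (norm_cexp_phase z.2 z.1 y).le
    calc ∫ x, φ x * (f x : ℂ)
        = ∫ x : ℝ, ∫ k : ℝ,
            Complex.exp (Complex.I * k * (x - y)) * ((f x : ℂ) * normalizedFT ψ k) := by
          congr 1; ext x
          rw [hinv x, ← integral_mul_const]
          congr 1; ext k; ring
      _ = ∫ k : ℝ, ∫ x : ℝ,
            Complex.exp (Complex.I * k * (x - y)) * ((f x : ℂ) * normalizedFT ψ k) :=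
          integral_integral_swap hi
      _ = ∫ k : ℝ, centredCF f y k * normalizedFT ψ k := by
          congr 1; ext k
          rw [centredCF, ← integral_mul_const]
          congr 1; ext x; ring
  have hcf : Integrable (fun k => centredCF f y k * normalizedFT ψ k) := by
    refine hψ.integrable_normalizedFT.bdd_mul (c := ∫ x, ‖f x‖)
      (continuous_centredCF hf y).aestronglyMeasurable (ae_of_all _ fun k => ?_)
    refine (norm_integral_le_integral_norm _).trans_eq ?_
    congr 1; ext x
    rw [norm_mul, norm_cexp_phase, one_mul, Complex.norm_real]
  rw [hswap, hy, ← integral_sub hcf hψ.integrable_normalizedFT]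
  congr 1; ext k; ring

/-- The mean increment rates of a test function converge to the pairing with the kernel. -/
theorem tendsto_increment_rate {p : ℝ → ℝ → ℝ → ℝ → ℝ} {κ : ℝ → ℝ → ℝ → ℂ} {y t : ℝ}
    (hi : ∀ δ, 0 < δ → Integrable (fun x => p x (t + δ) y t))
    (h0 : ∀ δ, 0 < δ → ∀ x, 0 ≤ p x (t + δ) y t)
    (h1 : ∀ δ, 0 < δ → ∫ x, p x (t + δ) y t = 1)
    (hc : ∀ k, HasCumulantRate p k y t (κ k y t)) {φ : ℝ → ℂ} (hφ : IsTestFunction φ) :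
    Tendsto (fun δ : ℝ => ((∫ x, φ x * (p x (t + δ) y t : ℂ)) - φ y) / (δ : ℂ)) (𝓝[>] 0)
      (𝓝 (kernelPairing κ φ y t)) := by
  have hψ := hφ.comp_add_right y
  obtain ⟨C, hC0, hC⟩ := exists_incrementCF_bound hi h0 h1 hc
  have hlim : Tendsto (fun δ : ℝ => ∫ k : ℝ, (incrementCF p k δ y t - 1) / (δ : ℂ)
      * normalizedFT (fun z => φ (z + y)) k) (𝓝[>] 0) (𝓝 (kernelPairing κ φ y t)) := by
    refine tendsto_integral_filter_of_dominated_convergence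
      (fun k => C * ((1 + k ^ 2) * ‖normalizedFT (fun z => φ (z + y)) k‖)) ?_ ?_
      (hψ.integrable_one_add_sq_mul_normalizedFT.const_mul C) (ae_of_all _ fun k => ?_)
    · filter_upwards [self_mem_nhdsWithin] with δ hδ
      exact (((continuous_centredCF (hi δ hδ) y).sub continuous_const).div_const
        _).aestronglyMeasurable.mul hψ.integrable_normalizedFT.aestronglyMeasurable
    · filter_upwards [hC] with δ h
      refine ae_of_all _ fun k => ?_
      rw [norm_mul, ← mul_assoc]
      exact mul_le_mul_of_nonneg_right (h k) (norm_nonneg _)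
    · exact (hc k).tendsto.mul_const _
  refine hlim.congr' ?_
  filter_upwards [self_mem_nhdsWithin] with δ hδ
  rw [integral_mul_sub_eq (hi δ hδ) hφ, ← integral_div]
  congr 1; ext k
  rw [incrementCF, centredCF]
  ring

end MarkovFP

/-! ### Chapman–Kolmogorov and the forward equation -/

namespace MarkovFP

namespace IsMarkovProcess

variable {Ω : Type*} [MeasurableSpace Ω] {P : Measure Ω} {X : ℝ → Ω → ℝ}
  {p : ℝ → ℝ → ℝ → ℝ → ℝ} {x₀ t₀ : ℝ}

theorem integrable_density (hX : IsMarkovProcess P X p x₀ t₀) {s t : ℝ} (hs : t₀ ≤ s)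
    (hst : s < t) (y : ℝ) : Integrable (fun x => p x t y s) :=
  integrable_of_integral_eq_one (hX.integral_density s t hs hst y)

theorem measurable_density_left (hX : IsMarkovProcess P X p x₀ t₀) {s t : ℝ} (hs : t₀ ≤ s)
    (hst : s < t) (y : ℝ) : Measurable (fun x => p x t y s) :=
  (hX.measurable_density s t hs hst).comp (measurable_id.prodMk measurable_const)

theorem past_le (hX : IsMarkovProcess P X p x₀ t₀) (s : ℝ) :
    past X t₀ s ≤ (inferInstance : MeasurableSpace Ω) :=
  iSup₂_le fun r hr => (hX.measurable_process r hr.1).comap_le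

/-- The expectation of the Markov property: conditioning on the past preserves the mean of the
indicator. -/
theorem measureReal_preimage [IsProbabilityMeasure P] (hX : IsMarkovProcess P X p x₀ t₀)
    {s t : ℝ} (hs : t₀ ≤ s) (hst : s < t) {A : Set ℝ} (hA : MeasurableSet A) :
    P.real (X t ⁻¹' A) = ∫ w, (∫ x in A, p x t (X s w) s) ∂P := by
  rw [← integral_congr_ae (hX.markov s t hs hst A hA), integral_condExp (hX.past_le s),
    integral_indicator_const _ (hX.measurable_process t (hs.trans hst.le) hA)]
  simp

theorem measureReal_preimage_eq_setIntegral [IsProbabilityMeasure P]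
    (hX : IsMarkovProcess P X p x₀ t₀) {t : ℝ} (ht : t₀ < t) {A : Set ℝ}
    (hA : MeasurableSet A) : P.real (X t ⁻¹' A) = ∫ x in A, p x t x₀ t₀ := by
  rw [hX.measureReal_preimage le_rfl ht hA]
  have : (fun w => ∫ x in A, p x t (X t₀ w) t₀) =ᵐ[P] fun _ => ∫ x in A, p x t x₀ t₀ := by
    filter_upwards [hX.start] with w hw
    rw [hw]
  rw [integral_congr_ae this]
  simp

/-- The law of `X t` has density `p(·,t|x₀,t₀)`. -/
theorem map_eq_withDensity [IsProbabilityMeasure P] (hX : IsMarkovProcess P X p x₀ t₀)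
    {t : ℝ} (ht : t₀ < t) :
    P.map (X t) = volume.withDensity (fun x => ENNReal.ofReal (p x t x₀ t₀)) := by
  ext A hA
  rw [Measure.map_apply (hX.measurable_process t ht.le) hA, withDensity_apply _ hA,
    ← ofReal_integral_eq_lintegral_ofReal (hX.integrable_density le_rfl ht x₀).integrableOn
      (ae_of_all _ fun x => hX.density_nonneg t₀ t le_rfl ht x x₀),
    ← hX.measureReal_preimage_eq_setIntegral ht hA, ofReal_measureReal]

theorem integral_comp_process [IsProbabilityMeasure P] (hX : IsMarkovProcess P X p x₀ t₀)
    {t : ℝ} (ht : t₀ < t) {g : ℝ → ℝ} (hg : StronglyMeasurable g) :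
    ∫ w, g (X t w) ∂P = ∫ y, g y * p y t x₀ t₀ := by
  rw [← integral_map (hX.measurable_process t ht.le).aemeasurable hg.aestronglyMeasurable,
    hX.map_eq_withDensity ht, integral_withDensity_eq_integral_toReal_smul
      (hX.measurable_density_left le_rfl ht x₀).ennreal_ofReal (by simp)]
  congr 1; ext y
  rw [ENNReal.toReal_ofReal (hX.density_nonneg t₀ t le_rfl ht y x₀), smul_eq_mul, mul_comm]

/-- By Tonelli: integrating over `x` first gives 1, and then the density in `y` is integrable. This
justifies the later exchanges of integrals. -/
theorem integrable_density_mul_density (hX : IsMarkovProcess P X p x₀ t₀) {t u : ℝ}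
    (ht : t₀ < t) (htu : t < u) :
    Integrable (fun z : ℝ × ℝ => p z.1 u z.2 t * p z.2 t x₀ t₀) (volume.prod volume) := by
  have hm : Measurable (fun z : ℝ × ℝ => p z.1 u z.2 t * p z.2 t x₀ t₀) :=
    (hX.measurable_density t u ht.le htu).mul
      ((hX.measurable_density_left le_rfl ht x₀).comp measurable_snd)
  refine (integrable_prod_iff' hm.aestronglyMeasurable).2 ⟨ae_of_all _ fun y =>
    (hX.integrable_density ht.le htu y).mul_const (p y t x₀ t₀), ?_⟩
  refine (hX.integrable_density le_rfl ht x₀).congr (ae_of_all _ fun y => ?_)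
  simp only [norm_mul]
  rw [integral_mul_const]
  simp only [Real.norm_of_nonneg (hX.density_nonneg t u ht.le htu _ _),
    Real.norm_of_nonneg (hX.density_nonneg t₀ t le_rfl ht _ _),
    hX.integral_density t u ht.le htu, one_mul]

/-- The Chapman–Kolmogorov equation. -/
theorem chapman_kolmogorov [IsProbabilityMeasure P] (hX : IsMarkovProcess P X p x₀ t₀)
    {t u : ℝ} (ht : t₀ < t) (htu : t < u) :
    (fun x => p x u x₀ t₀) =ᵐ[volume] fun x => ∫ y, p x u y t * p y t x₀ t₀ := by
  have hi := hX.integrable_density_mul_density ht htu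
  refine Integrable.ae_eq_of_forall_setIntegral_eq _ _
    (hX.integrable_density le_rfl (ht.trans htu) x₀) hi.integral_prod_left fun A hA _ => ?_
  have hg : StronglyMeasurable fun y => ∫ x in A, p x u y t :=
    StronglyMeasurable.integral_prod_left
      (hX.measurable_density t u ht.le htu).stronglyMeasurable
  rw [← hX.measureReal_preimage_eq_setIntegral (ht.trans htu) hA,
    hX.measureReal_preimage ht.le htu hA, hX.integral_comp_process ht hg]
  have hiA : Integrable (Function.uncurry fun x y : ℝ => p x u y t * p y t x₀ t₀)
      ((volume.restrict A).prod volume) := by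
    refine hi.mono_measure ?_
    exact Measure.prod_mono Measure.restrict_le_self le_rfl
  rw [integral_integral_swap hiA]
  congr 1; ext y
  rw [integral_mul_const]

/-- The pairing with a bounded continuous function, propagated from an intermediate time. -/
theorem integral_mul_density_eq [IsProbabilityMeasure P] (hX : IsMarkovProcess P X p x₀ t₀)
    {t u : ℝ} (ht : t₀ < t) (htu : t < u) {φ : ℝ → ℂ} {C : ℝ} (hφ : Continuous φ)
    (hC : ∀ x, ‖φ x‖ ≤ C) :
    Integrable (fun y => (∫ x, φ x * (p x u y t : ℂ)) * (p y t x₀ t₀ : ℂ)) ∧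
    ∫ x, φ x * (p x u x₀ t₀ : ℂ)
      = ∫ y, (∫ x, φ x * (p x u y t : ℂ)) * (p y t x₀ t₀ : ℂ) := by
  have hi : Integrable (Function.uncurry fun x y : ℝ =>
      φ x * ((p x u y t * p y t x₀ t₀ : ℝ) : ℂ)) (volume.prod volume) :=
    (hX.integrable_density_mul_density ht htu).ofReal.bdd_mul (c := C)
      (hφ.comp continuous_fst).aestronglyMeasurable (ae_of_all _ fun z => hC z.1)
  have hinner : ∀ y, ∫ x, φ x * ((p x u y t * p y t x₀ t₀ : ℝ) : ℂ)
      = (∫ x, φ x * (p x u y t : ℂ)) * (p y t x₀ t₀ : ℂ) := by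
    intro y
    rw [← integral_mul_const]
    congr 1; ext x
    push_cast; ring
  refine ⟨hi.integral_prod_right.congr (ae_of_all _ hinner), ?_⟩
  calc ∫ x, φ x * (p x u x₀ t₀ : ℂ)
      = ∫ x, ∫ y, φ x * ((p x u y t * p y t x₀ t₀ : ℝ) : ℂ) := by
        refine integral_congr_ae ?_
        filter_upwards [hX.chapman_kolmogorov ht htu] with x hx
        rw [hx, ← integral_complex_ofReal, ← integral_const_mul]
    _ = ∫ y, ∫ x, φ x * ((p x u y t * p y t x₀ t₀ : ℝ) : ℂ) := integral_integral_swap hi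
    _ = _ := by simp_rw [hinner]

/-- The forward equation in the sense of distributions, with the right time derivative. -/
theorem forward_equation [IsProbabilityMeasure P] (hX : IsMarkovProcess P X p x₀ t₀)
    {κ : ℝ → ℝ → ℝ → ℂ} {t : ℝ} (ht : t₀ < t) (hE : HasSmallTimeExpansion p κ x₀ t₀ t)
    {φ : ℝ → ℂ} (hφ : IsTestFunction φ) :
    Integrable (fun y => kernelPairing κ φ y t * (p y t x₀ t₀ : ℂ)) ∧
      HasDerivWithinAt (densityPairing p x₀ t₀ φ) (generatedPairing p κ x₀ t₀ φ t)
        (Set.Ici t) t := by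
  obtain ⟨g, hg, hdom⟩ := hE.dominated φ hφ
  obtain ⟨C, hC⟩ := hφ.2.exists_bound_of_continuous hφ.1.continuous
  have hpt := hX.integrable_density le_rfl ht x₀
  -- The rate is weighted by the density before any limit, so points with `p y t x₀ t₀ = 0`, where
  -- nothing is assumed, contribute zero.
  let R : ℝ → ℝ → ℂ := fun δ y =>
    ((∫ x, φ x * (p x (t + δ) y t : ℂ)) - φ y) / (δ : ℂ) * (p y t x₀ t₀ : ℂ)
  have hφp : Integrable (fun y => φ y * (p y t x₀ t₀ : ℂ)) :=
    hpt.ofReal.bdd_mul (c := C) hφ.1.continuous.aestronglyMeasurable (ae_of_all _ hC)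
  have hReq : ∀ δ y, R δ y = (δ : ℂ)⁻¹ * ((∫ x, φ x * (p x (t + δ) y t : ℂ))
      * (p y t x₀ t₀ : ℂ) - φ y * (p y t x₀ t₀ : ℂ)) := by
    intro δ y; simp only [R]; ring
  have hRint : ∀ δ, 0 < δ → Integrable (R δ) := by
    intro δ hδ
    have h := (hX.integral_mul_density_eq ht (lt_add_of_pos_right t hδ) hφ.1.continuous hC).1
    exact ((h.sub hφp).const_mul (δ : ℂ)⁻¹).congr (ae_of_all _ fun y => (hReq δ y).symm)
  have hRbound : ∀ᶠ δ in 𝓝[>] (0 : ℝ), ∀ᵐ y, ‖R δ y‖ ≤ g y * p y t x₀ t₀ := by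
    filter_upwards [hdom, self_mem_nhdsWithin] with δ h hδ
    filter_upwards [h] with y hy
    have hδ' : (0 : ℝ) < δ := hδ
    by_cases h0 : p y t x₀ t₀ = 0
    · simp [R, h0]
    · simp only [R]
      rw [norm_mul, norm_div, Complex.norm_real, Complex.norm_real, Real.norm_of_nonneg hδ'.le,
        Real.norm_of_nonneg (hX.density_nonneg t₀ t le_rfl ht y x₀)]
      refine mul_le_mul_of_nonneg_right ?_ (hX.density_nonneg t₀ t le_rfl ht y x₀)
      rw [div_le_iff₀ hδ', mul_comm]
      exact hy h0
  have hRlim : ∀ᵐ y, Tendsto (fun δ => R δ y) (𝓝[>] 0)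
      (𝓝 (kernelPairing κ φ y t * (p y t x₀ t₀ : ℂ))) := by
    filter_upwards [hE.rate] with y hy
    by_cases h0 : p y t x₀ t₀ = 0
    · simp [R, h0]
    · exact (tendsto_increment_rate
        (fun δ hδ => hX.integrable_density ht.le (lt_add_of_pos_right t hδ) y)
        (fun δ hδ x => hX.density_nonneg t (t + δ) ht.le (lt_add_of_pos_right t hδ) x y)
        (fun δ hδ => hX.integral_density t (t + δ) ht.le (lt_add_of_pos_right t hδ) y)
        (hy h0) hφ).mul_const _
  have hu : Tendsto (fun n : ℕ => (1 : ℝ) / (n + 1)) atTop (𝓝[>] 0) :=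
    tendsto_nhdsWithin_iff.2 ⟨tendsto_one_div_add_atTop_nhds_zero_nat,
      Eventually.of_forall fun n => Set.mem_Ioi.2 (by positivity)⟩
  refine ⟨?_, ?_⟩
  -- Measurability in `y` is inherited as an almost everywhere limit along `δ = 1/(n+1)`;
  -- countability of the sequence also merges the exceptional null sets of the bounds.
  · refine hg.mono' (aestronglyMeasurable_of_tendsto_ae atTop
      (f := fun n : ℕ => R (1 / (n + 1))) (fun n => (hRint _ (by positivity)).1) ?_) ?_
    · filter_upwards [hRlim] with y hy using hy.comp hu
    · obtain ⟨N, hN⟩ := eventually_atTop.1 (hu.eventually hRbound)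
      have hall : ∀ᵐ y, ∀ n : ℕ, N ≤ n → ‖R (1 / (n + 1)) y‖ ≤ g y * p y t x₀ t₀ := by
        refine ae_all_iff.2 fun n => ?_
        by_cases hn : N ≤ n
        · filter_upwards [hN n hn] with y hy _ using hy
        · exact ae_of_all _ fun y h => absurd h hn
      filter_upwards [hRlim, hall] with y hy hb
      exact le_of_tendsto (hy.comp hu).norm (eventually_atTop.2 ⟨N, hb⟩)
  · rw [hasDerivWithinAt_iff_tendsto_slope, Set.Ici_sdiff_left]
    have hlim : Tendsto (fun δ => ∫ y, R δ y) (𝓝[>] 0)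
        (𝓝 (generatedPairing p κ x₀ t₀ φ t)) := by
      refine tendsto_integral_filter_of_dominated_convergence _ ?_ hRbound hg hRlim
      filter_upwards [self_mem_nhdsWithin] with δ hδ using (hRint δ hδ).1
    have hshift : Tendsto (fun s : ℝ => s - t) (𝓝[>] t) (𝓝[>] 0) := by
      refine tendsto_nhdsWithin_iff.2 ⟨?_, ?_⟩
      · have : Tendsto (fun s : ℝ => s - t) (𝓝 t) (𝓝 (t - t)) :=
          (continuous_id.sub continuous_const).tendsto t
        rw [sub_self] at this
        exact this.mono_left nhdsWithin_le_nhds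
      · filter_upwards [self_mem_nhdsWithin] with s hs
        exact Set.mem_Ioi.2 (sub_pos.2 (Set.mem_Ioi.1 hs))
    refine (hlim.comp hshift).congr' ?_
    filter_upwards [self_mem_nhdsWithin] with s hs
    have hs' : t < s := hs
    obtain ⟨h1, h2⟩ := hX.integral_mul_density_eq ht hs' hφ.1.continuous hC
    simp only [Function.comp, hReq, add_sub_cancel]
    rw [integral_const_mul, integral_sub h1 hφp, ← h2, slope_def_module]
    simp only [densityPairing, Complex.real_smul]
    push_cast
    rfl

end IsMarkovProcess

end MarkovFP

/-! ### From right derivatives to two-sided and pointwise derivatives -/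

namespace MarkovFP

section RightDerivative

variable {E : Type*} [NormedAddCommGroup E]

theorem intervalIntegrable_of_continuousOn_Ioo {f : ℝ → E} {a b s t : ℝ}
    (hf : ContinuousOn f (Set.Ioo a b)) (hs : s ∈ Set.Ioo a b) (ht : t ∈ Set.Ioo a b) :
    IntervalIntegrable f volume s t :=
  (hf.mono (Set.ordConnected_Ioo.uIcc_subset hs ht)).intervalIntegrable

variable [NormedSpace ℝ E] [CompleteSpace E]

/-- The fundamental theorem of calculus needs only continuity of `f` and a right derivative in the
interior. -/
theorem integral_eq_sub_of_hasDerivWithinAt_Ici {f f' : ℝ → E} {a b s t : ℝ}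
    (hf : ContinuousOn f (Set.Ioo a b)) (hf' : ContinuousOn f' (Set.Ioo a b))
    (hd : ∀ t ∈ Set.Ioo a b, HasDerivWithinAt f (f' t) (Set.Ici t) t)
    (hs : s ∈ Set.Ioo a b) (ht : t ∈ Set.Ioo a b) :
    ∫ r in s..t, f' r = f t - f s := by
  have hsub := Set.ordConnected_Ioo.uIcc_subset hs ht
  refine intervalIntegral.integral_eq_sub_of_hasDeriv_right (hf.mono hsub) (fun x hx => ?_)
    (intervalIntegrable_of_continuousOn_Ioo hf' hs ht)
  exact (hd x (hsub ⟨hx.1.le, hx.2.le⟩)).mono Set.Ioi_subset_Ici_self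

theorem hasDerivAt_of_integral_eq_sub {f f' : ℝ → E} {a b t : ℝ}
    (hf' : ContinuousOn f' (Set.Ioo a b)) (ht : t ∈ Set.Ioo a b)
    (h : ∀ u ∈ Set.Ioo a b, ∫ r in t..u, f' r = f u - f t) : HasDerivAt f (f' t) t := by
  have h1 : HasDerivAt (fun u => ∫ r in t..u, f' r) (f' t) t :=
    intervalIntegral.integral_hasDerivAt_right (intervalIntegrable_of_continuousOn_Ioo hf' ht ht)
      (hf'.stronglyMeasurableAtFilter isOpen_Ioo t ht)
      (hf'.continuousAt (isOpen_Ioo.mem_nhds ht))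
  refine (h1.add_const (f t)).congr_of_eventuallyEq ?_
  filter_upwards [isOpen_Ioo.mem_nhds ht] with u hu
  rw [h u hu, sub_add_cancel]

end RightDerivative

theorem continuousOn_integral_testFunction_mul {q : ℝ → ℝ → ℝ} {T : Set ℝ}
    (hq : ContinuousOn (fun z : ℝ × ℝ => q z.1 z.2) (Set.univ ×ˢ T)) {φ : ℝ → ℂ}
    (hφ : IsTestFunction φ) : ContinuousOn (fun t => ∫ x, φ x * (q x t : ℂ)) T := by
  refine continuousOn_integral_of_compact_support (f := fun t x => φ x * (q x t : ℂ)) hφ.2 ?_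
    fun t x _ hx => by rw [image_eq_zero_of_notMem_tsupport hx, zero_mul]
  refine (hφ.1.continuous.comp continuous_snd).continuousOn.mul
    (Complex.continuous_ofReal.comp_continuousOn ?_)
  exact hq.comp (f := Prod.swap) continuous_swap.continuousOn fun z hz => ⟨trivial, hz.1⟩

theorem continuous_slice {q : ℝ → ℝ → ℝ} {T : Set ℝ}
    (hq : ContinuousOn (fun z : ℝ × ℝ => q z.1 z.2) (Set.univ ×ˢ T)) {t : ℝ} (ht : t ∈ T) :
    Continuous fun x => q x t := by
  rw [← continuousOn_univ]
  exact hq.comp (f := fun x => (x, t)) (by fun_prop) fun x _ => ⟨trivial, ht⟩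

/-- A weak form of `p(x,t) - p(x,s) = ∫ q(x,r) dr`, tested against smooth functions, implies the
pointwise identity. -/
theorem integral_eq_sub_of_weak {p q : ℝ → ℝ → ℝ} {T : Set ℝ} (hT : T.OrdConnected)
    (hp : ContinuousOn (fun z : ℝ × ℝ => p z.1 z.2) (Set.univ ×ˢ T))
    (hq : ContinuousOn (fun z : ℝ × ℝ => q z.1 z.2) (Set.univ ×ˢ T))
    {s t : ℝ} (hs : s ∈ T) (ht : t ∈ T)
    (h : ∀ φ, IsTestFunction φ → ∫ r in s..t, ∫ x, φ x * (q x r : ℂ)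
      = (∫ x, φ x * (p x t : ℂ)) - ∫ x, φ x * (p x s : ℂ)) (x : ℝ) :
    ∫ r in s..t, q x r = p x t - p x s := by
  have hsub : Set.uIcc s t ⊆ T := hT.uIcc_subset hs ht
  -- Clamping time to `[s, t]` makes `q x (c r)` continuous on the whole plane without changing the
  -- integral.
  let c : ℝ → ℝ := fun r => Set.projIcc (min s t) (max s t) min_le_max r
  have hc : Continuous c := continuous_subtype_val.comp continuous_projIcc
  have hcmem : ∀ r, c r ∈ T := fun r => hsub (Set.projIcc (min s t) (max s t) min_le_max r).2
  have hceq : ∀ r ∈ Set.uIcc s t, c r = r := fun r hr => by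
    simp only [c]; rw [Set.projIcc_of_mem _ hr]
  have hQ : Continuous fun z : ℝ × ℝ => q z.1 (c z.2) := by
    rw [← continuousOn_univ]
    exact hq.comp (f := fun z : ℝ × ℝ => (z.1, c z.2)) (by fun_prop)
      fun z _ => ⟨trivial, hcmem _⟩
  have hI : ∀ x, ∫ r in s..t, q x r = ∫ r in s..t, q x (c r) := fun x =>
    intervalIntegral.integral_congr fun r hr => by simp only [hceq r hr]
  have hIcont : Continuous fun x => ∫ r in s..t, q x r := by
    simp_rw [hI]
    exact intervalIntegral.continuous_parametric_intervalIntegral_of_continuous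
      (f := fun x r => q x (c r)) hQ continuous_const
  have hpt := continuous_slice hp ht
  have hps := continuous_slice hp hs
  have hdiff : Continuous fun x => (∫ r in s..t, q x r) - (p x t - p x s) :=
    hIcont.sub (hpt.sub hps)
  have hae : ∀ᵐ x, (∫ r in s..t, q x r) - (p x t - p x s) = 0 := by
    refine ae_eq_zero_of_integral_contDiff_smul_eq_zero hdiff.locallyIntegrable
      fun g hg hgs => ?_
    have hint : ∀ {f : ℝ → ℝ}, Continuous f → Integrable fun x => g x * f x := fun hf =>
      (hg.continuous.mul hf).integrable_of_hasCompactSupport hgs.mul_right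
    have hφ : IsTestFunction fun x => (g x : ℂ) :=
      ⟨Complex.ofRealCLM.contDiff.comp hg, hgs.comp_left Complex.ofReal_zero⟩
    have hreal := h _ hφ
    simp only [← Complex.ofReal_mul, integral_complex_ofReal,
      intervalIntegral.integral_ofReal] at hreal
    rw [← Complex.ofReal_sub, Complex.ofReal_inj] at hreal
    have hfub : ∫ r in s..t, ∫ x, g x * q x r = ∫ x, g x * ∫ r in s..t, q x r := by
      -- Restricting `x` to the compact support of `g` makes the domain compact, so continuity
      -- suffices for Fubini.
      have hK : ∀ f : ℝ → ℝ, ∫ x in tsupport g, g x * f x = ∫ x, g x * f x := fun f =>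
        setIntegral_eq_integral_of_forall_compl_eq_zero fun x hx => by
          rw [image_eq_zero_of_notMem_tsupport hx, zero_mul]
      have hi : Integrable (Function.uncurry fun r x : ℝ => g x * q x (c r))
          ((volume.restrict (Set.uIoc s t)).prod (volume.restrict (tsupport g))) := by
        rw [Measure.prod_restrict]
        have hcont : Continuous (Function.uncurry fun r x : ℝ => g x * q x (c r)) :=
          (hg.continuous.comp continuous_snd).mul (hQ.comp continuous_swap)
        exact (hcont.continuousOn.integrableOn_compact
          (isCompact_uIcc.prod hgs)).mono_set
            (Set.prod_mono Set.uIoc_subset_uIcc subset_rfl)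
      calc ∫ r in s..t, ∫ x, g x * q x r
          = ∫ r in s..t, ∫ x in tsupport g, g x * q x (c r) := by
            refine intervalIntegral.integral_congr fun r hr => ?_
            simp only [hceq r hr]
            exact (hK _).symm
        _ = ∫ x in tsupport g, ∫ r in s..t, g x * q x (c r) :=
            intervalIntegral_integral_swap hi
        _ = ∫ x, g x * ∫ r in s..t, q x r := by
            simp_rw [intervalIntegral.integral_const_mul, ← hI]
            exact hK _
    simp only [smul_eq_mul, mul_sub]
    have h2 : Integrable fun x => g x * p x t - g x * p x s := (hint hpt).sub (hint hps)
    rw [integral_sub (hint hIcont) h2, integral_sub (hint hpt) (hint hps), ← hfub, hreal,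
      sub_self]
  have := congrFun ((Continuous.ae_eq_iff_eq volume hdiff continuous_const).1 hae) x
  exact sub_eq_zero.1 this

end MarkovFP

theorem proposition2 {Ω : Type*} [MeasurableSpace Ω] (P : Measure Ω) [IsProbabilityMeasure P]
    (X : ℝ → Ω → ℝ) (p : ℝ → ℝ → ℝ → ℝ → ℝ) (x₀ t₀ : ℝ)
    (hX : MarkovFP.IsMarkovProcess P X p x₀ t₀) (κ : ℝ → ℝ → ℝ → ℂ) :
    -- the equation in the sense of distributions, with the forward time derivative
    (∀ t, t₀ < t → MarkovFP.HasSmallTimeExpansion p κ x₀ t₀ t →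
      (∀ᵐ y, p y t x₀ t₀ ≠ 0 →
        Measurable (fun k => κ k y t) ∧ ∃ C : ℝ, ∀ k, ‖κ k y t‖ ≤ C * (1 + k ^ 2)) ∧
      ∀ φ, MarkovFP.IsTestFunction φ →
        Integrable (fun y => MarkovFP.kernelPairing κ φ y t * (p y t x₀ t₀ : ℂ)) ∧
        HasDerivWithinAt (MarkovFP.densityPairing p x₀ t₀ φ)
          (MarkovFP.generatedPairing p κ x₀ t₀ φ t) (Set.Ici t) t) ∧
    -- on a time interval where both sides are continuous in time, the derivative is two-sided
    (∀ a b, t₀ ≤ a → (∀ t ∈ Set.Ioo a b, MarkovFP.HasSmallTimeExpansion p κ x₀ t₀ t) →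
      ∀ φ, MarkovFP.IsTestFunction φ →
        ContinuousOn (MarkovFP.densityPairing p x₀ t₀ φ) (Set.Ioo a b) →
        ContinuousOn (MarkovFP.generatedPairing p κ x₀ t₀ φ) (Set.Ioo a b) →
        ∀ t ∈ Set.Ioo a b, HasDerivAt (MarkovFP.densityPairing p x₀ t₀ φ)
          (MarkovFP.generatedPairing p κ x₀ t₀ φ t) t) ∧
    -- where the right-hand side is a continuous function `q`, the equation holds pointwise
    (∀ a b, t₀ ≤ a → (∀ t ∈ Set.Ioo a b, MarkovFP.HasSmallTimeExpansion p κ x₀ t₀ t) →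
      ContinuousOn (fun z : ℝ × ℝ => p z.1 z.2 x₀ t₀) (Set.univ ×ˢ Set.Ioo a b) →
      ∀ q : ℝ → ℝ → ℝ,
        ContinuousOn (fun z : ℝ × ℝ => q z.1 z.2) (Set.univ ×ˢ Set.Ioo a b) →
        (∀ t ∈ Set.Ioo a b, ∀ φ, MarkovFP.IsTestFunction φ →
          MarkovFP.generatedPairing p κ x₀ t₀ φ t = ∫ x, φ x * (q x t : ℂ)) →
        ∀ x, ∀ t ∈ Set.Ioo a b, HasDerivAt (fun s => p x s x₀ t₀) (q x t) t) := by
  refine ⟨fun t ht hE => ⟨?_, fun φ hφ => hX.forward_equation ht hE hφ⟩, ?_, ?_⟩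
  · filter_upwards [hE.rate] with y hy h0
    exact MarkovFP.cumulantRate_measurable_and_bound
      (fun δ hδ => hX.integrable_density ht.le (lt_add_of_pos_right t hδ) y)
      (fun δ hδ x => hX.density_nonneg t (t + δ) ht.le (lt_add_of_pos_right t hδ) x y)
      (fun δ hδ => hX.integral_density t (t + δ) ht.le (lt_add_of_pos_right t hδ) y) (hy h0)
  · intro a b ha hE φ hφ hd hg t ht
    exact MarkovFP.hasDerivAt_of_integral_eq_sub hg ht fun u hu =>
      MarkovFP.integral_eq_sub_of_hasDerivWithinAt_Ici hd hg
        (fun r hr => (hX.forward_equation (ha.trans_lt hr.1) (hE r hr) hφ).2) ht hu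
  · intro a b ha hE hp q hq hgen x t ht
    have hqx : ContinuousOn (q x) (Set.Ioo a b) :=
      hq.comp (f := fun r => (x, r)) (by fun_prop) fun r hr => ⟨trivial, hr⟩
    refine MarkovFP.hasDerivAt_of_integral_eq_sub hqx ht fun u hu => ?_
    refine MarkovFP.integral_eq_sub_of_weak (p := fun x s => p x s x₀ t₀) Set.ordConnected_Ioo
      hp hq ht hu (fun φ hφ => ?_) x
    -- Both continuity requirements in time follow from the joint continuity of `p` and `q`, since
    -- `φ` has compact support.
    refine MarkovFP.integral_eq_sub_of_hasDerivWithinAt_Ici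
      (MarkovFP.continuousOn_integral_testFunction_mul (q := fun x s => p x s x₀ t₀) hp hφ)
      (MarkovFP.continuousOn_integral_testFunction_mul hq hφ) (fun r hr => ?_) ht hu
    rw [← hgen r hr φ hφ]
    exact (hX.forward_equation (ha.trans_lt hr.1) (hE r hr) hφ).2
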